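/- Let $T$ be an infinite tree in which every vertex has finite degree, with a root $o$ of degree $1$. For each vertex $v\neq o$ let $v^{(0)}$ be its parent (its neighbour on the path to $o$) and let $v^{(1)},\dots,v^{(b(v))}$ be its $b(v)\ge 0$ children, labelled in any order. A rotor configuration is a map $r$ assigning to each vertex $v\ne o$ an integer $r(v)$ with $0\le r(v)\le b(v)$, meaning that the rotor at $v$ points to $v^{(r(v))}$; the rotor at $o$ always points to its only neighbour. In each step of the rotor walk, the rotor at the particle's current location $v$ is advanced to the next neighbour in the cyclic order $v^{(0)},v^{(1)},\dots,v^{(b(v))}$, and the particle then moves to that neighbour. Start a particle at $o$ and run the rotor walk until its first return to $o$. Either it returns after finitely many steps, or it never returns, in which case it visits each vertex only finitely often (it escapes to infinity); in both cases the final positions of all rotors are well defined. Run $n$ such walks from $o$ in succession, the first with initial configuration $r$ and each later one starting with the rotor positions left by its predecessor, and let $E_n(T,r)$ be the number of these $n$ particles that escape to infinity. Let $\alpha(T)$ be the probability that simple symmetric random walk on $T$ started at $o$ never returns to $o$. If $r$ is any rotor configuration for which only finitely many vertices $v\neq o$ satisfy $r(v)=b(v)$, then $$\lim_{n\to\infty}\frac{E_n(T,r)}{n}=\alpha(T).$$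 -/

import Mathlib

open MeasureTheory ProbabilityTheory Filter Topology

/-- A locally finite tree with a root of degree one, together with the cyclic orders of neighbours.
For `v ≠ root`, `nbr v 0` is the parent of `v`, and `nbr v 1, …, nbr v (b v)` are its `b v`
children, listed in the cyclic order in which the rotor at `v` serves them. -/
structure RotorTree (V : Type*) where
  graph : SimpleGraph V
  isTree : graph.IsTree
  root : V
  /-- Degree minus one: for `v ≠ root` this is the number of children of `v`. -/
  b : V → ℕ
  /-- The labelling `v^(0), …, v^(b)` of all neighbours of `v`. -/
  nbr : (v : V) → Fin (b v + 1) ≃ graph.neighborSet v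
  /-- The root has exactly one neighbour. -/
  b_root : b root = 0
  /-- For `v ≠ root`, the neighbour with label `0` is the one on the path from `v` to the root. -/
  nbr_zero : ∀ v, v ≠ root → ∀ p : graph.Walk v root, p.IsPath → (nbr v 0 : V) ∈ p.support

namespace RotorTree

variable {V : Type*} (T : RotorTree V)

/-- A rotor configuration: `0 ≤ r v ≤ b v` for all `v`, the rotor at `v` pointing to `nbr v (r v)`.
At the root there is only one possible value. -/
abbrev RotorConfig : Type _ := (v : V) → Fin (T.b v + 1)

open Classical in
/-- One step of the rotor walk: increment the rotor at the current location (addition in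
`Fin (b v + 1)` is cyclic), then move to the neighbour it now points to. -/
noncomputable def step (x : V × T.RotorConfig) : V × T.RotorConfig :=
  (T.nbr x.1 (x.2 x.1 + 1), Function.update x.2 x.1 (x.2 x.1 + 1))

/-- Location and rotors at time `t`, for the walk from the root with initial configuration `r`. -/
noncomputable def walk (r : T.RotorConfig) (t : ℕ) : V × T.RotorConfig :=
  T.step^[t] (T.root, r)

/-- The particle started at the root returns to the root. -/
def Returns (r : T.RotorConfig) : Prop :=
  ∃ t, 0 < t ∧ (T.walk r t).1 = T.root

open Classical in
/-- The rotor configuration once the walk is complete: the one at the first return to the root or,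
if there is no return, the eventual position of every rotor (which exists, see
`eventually_eq_after`). -/
noncomputable def after (r : T.RotorConfig) : T.RotorConfig :=
  if h : T.Returns r then (T.walk r (Nat.find h)).2
  else fun v => Classical.epsilon fun a => ∀ᶠ t in atTop, (T.walk r t).2 v = a

open Classical in
/-- The escape number `E_n(T, r)`: the number of particles, among `n` run successively from the
root, that never return to the root. -/
noncomputable def escapes (r : T.RotorConfig) (n : ℕ) : ℕ :=
  ((Finset.range n).filter fun i => ¬ T.Returns (T.after^[i] r)).card

lemma walk_succ (r : T.RotorConfig) (t : ℕ) : T.walk r (t + 1) = T.step (T.walk r t) :=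
  Function.iterate_succ_apply' _ _ _

lemma walk_rotor_of_ne (r : T.RotorConfig) (v : V) (t n : ℕ)
    (h : ∀ u, t ≤ u → u < t + n → (T.walk r u).1 ≠ v) :
    (T.walk r (t + n)).2 v = (T.walk r t).2 v := by
  classical
  induction n with
  | zero => rfl
  | succ n ih =>
    rw [← ih fun u h1 h2 => h u h1 (by omega), ← Nat.add_assoc, walk_succ]
    exact Function.update_of_ne (h (t + n) (by omega) (by omega)).symm _ _

open Fin.CommRing in
lemma frequently_nbr (r : T.RotorConfig) (v : V)
    (hv : ∃ᶠ t in atTop, (T.walk r t).1 = v) (k : Fin (T.b v + 1)) :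
    ∃ᶠ t in atTop, (T.walk r t).1 = T.nbr v k := by
  classical
  rw [frequently_atTop] at hv ⊢
  intro N
  obtain ⟨t₀, ht₀, hv₀⟩ := hv N
  have key : ∀ j : ℕ, ∃ t ≥ N, (T.walk r t).1 = v ∧
      (T.walk r t).2 v = (T.walk r t₀).2 v + (j : Fin (T.b v + 1)) := by
    intro j
    induction j with
    | zero => exact ⟨t₀, ht₀, hv₀, by simp⟩
    | succ j ih =>
      obtain ⟨t, ht, htv, hr⟩ := ih
      have hex : ∃ n, (T.walk r (t + 1 + n)).1 = v := by
        obtain ⟨s, hs, hsv⟩ := hv (t + 1)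
        exact ⟨s - (t + 1), by rwa [Nat.add_sub_cancel' hs]⟩
      refine ⟨t + 1 + Nat.find hex, by omega, Nat.find_spec hex, ?_⟩
      rw [walk_rotor_of_ne T r v (t + 1) (Nat.find hex) ?_, walk_succ]
      · subst htv
        simp only [step, Function.update_self, hr]
        push_cast
        rw [add_assoc]
      · intro u h1 h2 h3
        exact Nat.find_min hex (m := u - (t + 1)) (by omega) (by rwa [Nat.add_sub_cancel' h1])
  obtain ⟨t, ht, htv, hr⟩ := key (k - 1 - (T.walk r t₀).2 v : Fin (T.b v + 1)).val
  refine ⟨t + 1, by omega, ?_⟩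
  subst htv
  rw [walk_succ]
  simp only [step, hr]
  congr 2
  simp

/-- A walk that never returns to the root visits every vertex only finitely often, so that the
final rotor positions are well defined. -/
lemma eventually_eq_after (r : T.RotorConfig) (h : ¬ T.Returns r) (v : V) :
    ∀ᶠ t in atTop, (T.walk r t).2 v = T.after r v := by
  have hroot : ¬ ∃ᶠ t in atTop, (T.walk r t).1 = T.root := by
    intro hf
    obtain ⟨t, ht, htr⟩ := frequently_atTop.1 hf 1
    exact h ⟨t, ht, htr⟩
  have hfin : ¬ ∃ᶠ t in atTop, (T.walk r t).1 = v := by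
    obtain ⟨p⟩ := T.isTree.connected.preconnected v T.root
    have : ∀ {x y : V}, T.graph.Walk x y → (∃ᶠ t in atTop, (T.walk r t).1 = x) →
        ∃ᶠ t in atTop, (T.walk r t).1 = y := by
      intro x y p
      induction p with
      | nil => exact id
      | @cons x z y hxz p ih =>
        intro hx
        have := T.frequently_nbr r x hx ((T.nbr x).symm ⟨z, hxz⟩)
        rw [Equiv.apply_symm_apply] at this
        exact ih this
    exact fun hv => hroot (this p hv)
  have hex : ∃ a, ∀ᶠ t in atTop, (T.walk r t).2 v = a := by
    obtain ⟨N, hN⟩ := eventually_atTop.1 (not_frequently.1 hfin)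
    refine ⟨(T.walk r N).2 v, eventually_atTop.2 ⟨N, fun t ht => ?_⟩⟩
    have := T.walk_rotor_of_ne r v N (t - N) fun u hu _ => hN u hu
    rwa [Nat.add_sub_cancel' ht] at this
  rw [after, dif_neg h]
  exact Classical.epsilon_spec hex

section RandomWalk

variable [MeasurableSpace V] [DiscreteMeasurableSpace V]

/-- Transition kernel of simple random walk: move to a uniformly chosen neighbour. -/
noncomputable def srwKernel : Kernel V V where
  toFun v := ((PMF.uniformOfFintype (Fin (T.b v + 1))).map fun i => (T.nbr v i : V)).toMeasure
  measurable' := Measurable.of_discrete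

instance : IsMarkovKernel T.srwKernel :=
  ⟨fun _ => PMF.toMeasure.isProbabilityMeasure _⟩

/-- The law, on trajectories `ℕ → V`, of simple random walk started at `v`. -/
noncomputable def srwLaw (v : V) : Measure (ℕ → V) :=
  Kernel.traj (X := fun _ => V)
    (fun n => T.srwKernel.comap (fun x : (i : Finset.Iic n) → V => x ⟨n, by simp⟩)
      (measurable_pi_apply _))
    0 (fun _ => v)

/-- The probability that simple random walk started at the root never returns to the root. -/
noncomputable def escapeProb : ℝ :=
  (T.srwLaw T.root).real {ω | ∀ t, 0 < t → ω t ≠ T.root}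

end RandomWalk

end RotorTree

/-! Let c be the neighbour of the root. A particle escapes exactly when its excursion from c never
ends, so the escape number is that of excursions from c (`escapes_eq`), and more generally one
counts the escapes E_v(n) among n excursions from v.

An excursion through a child sees and changes only the rotors below that child. Hence n excursions
from v amount to k returns to the parent together with m_i successive excursions from each child,
and E_v(n) = n - k = ∑ E_i(m_i). Since the rotor at v turns cyclically, every m_i differs from k by
at most one (`exists_excursionEscapes_eq_sum`). This mirrors the random walk recursion q(v) =
S/(1+S), S = ∑ q(v_i), satisfied by the escape probability q = `limitProb`, and the identity E - qn
= (E - Sk)/(1+S) carries bounds for the children up to v.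

Upper bound: induction on h gives E_v(n) ≤ `levelProb h v` * n + O(1), and `levelProb h v` decreases
to q(v). Lower bound: rounding errors could accumulate over infinitely many levels. If no rotor
below v is in its last position, every excursion from an untouched subtree escapes, and the
potential min(E, M) + n/M absorbs the errors (`limitProb_mul_sub_le_of_forall_lt`). The finitely
many exceptional vertices lie in finitely many levels, which cost only a constant and an arbitrarily
small slope (`exists_limitProb_mul_sub_le`).

It remains to see that q(c) is the escape probability of the actual random walk: the hitting
probabilities of the root are squeezed between two bounds (`tendsto_hitProb_parent_root`), then
linked to the trajectory measure (`escapeProb_eq`). -/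

namespace RotorTree

variable {V : Type*} (T : RotorTree V)

/-! ### Parents, children, depth and subtrees. -/

section Structure

/-- The neighbour of `v` with label `0`. -/
def parent (v : V) : V := T.nbr v 0

/-- The children of `v`, in the order in which the rotor at `v` serves them. -/
def child (v : V) (i : Fin (T.b v)) : V := T.nbr v i.succ

/-- The distance to the root. -/
noncomputable def depth (v : V) : ℕ := T.graph.dist T.root v

lemma adj_parent (v : V) : T.graph.Adj v (T.parent v) := (T.nbr v 0).2

lemma adj_child (v : V) (i : Fin (T.b v)) : T.graph.Adj v (T.child v i) := (T.nbr v i.succ).2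

lemma child_injective (v : V) : Function.Injective (T.child v) := fun _ _ h =>
  Fin.succ_injective _ ((T.nbr v).injective (Subtype.ext h))

/-- Prepending v to a geodesic from w gives a path to the root. By `nbr_zero` the parent lies on it,
and in an acyclic graph the only neighbour of v on a path starting at v is its second vertex. -/
lemma eq_parent_of_depth {v w : V} (h : T.graph.Adj v w) (hd : T.depth v = T.depth w + 1) :
    w = T.parent v := by
  have hv : v ≠ T.root := by
    rintro rfl
    simp [depth] at hd
  obtain ⟨q, hq⟩ := T.isTree.connected.exists_walk_length_eq_dist w T.root
  have hp : (q.cons h).IsPath := by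
    refine SimpleGraph.Walk.isPath_of_length_eq_dist _ ?_
    rw [SimpleGraph.Walk.length_cons, hq, SimpleGraph.dist_comm, SimpleGraph.dist_comm (u := v)]
    exact hd.symm
  have h0 := T.nbr_zero v hv _ hp
  have := T.isTree.isAcyclic.eq_snd_of_adj_start hp (T.adj_parent v) h0
  simpa using this.symm

lemma depth_parent {v : V} (hv : v ≠ T.root) : T.depth v = T.depth (T.parent v) + 1 := by
  obtain h | h := T.isTree.dist_eq_dist_add_one_of_adj T.root (T.adj_parent v)
  · exact h
  exfalso
  classical
  obtain ⟨p, hp⟩ := T.isTree.connected.exists_walk_length_eq_dist v T.root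
  have h0 := T.nbr_zero v hv p (SimpleGraph.Walk.isPath_of_length_eq_dist _ hp)
  have h1 := SimpleGraph.dist_le (p.dropUntil _ h0)
  have h2 := p.length_dropUntil_le_length h0
  rw [SimpleGraph.dist_comm] at h1 hp
  simp only [parent] at h
  omega

lemma depth_child {v : V} (i : Fin (T.b v)) : T.depth (T.child v i) = T.depth v + 1 := by
  obtain h | h := T.isTree.dist_eq_dist_add_one_of_adj T.root (T.adj_child v i)
  · have := (T.nbr v).injective (Subtype.ext (T.eq_parent_of_depth (T.adj_child v i) h))
    exact absurd this (Fin.succ_ne_zero i)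
  · exact h

lemma parent_child {v : V} (i : Fin (T.b v)) : T.parent (T.child v i) = v :=
  (T.eq_parent_of_depth (T.adj_child v i).symm (T.depth_child i)).symm

lemma child_ne_root {v : V} (i : Fin (T.b v)) : T.child v i ≠ T.root := by
  intro h
  have := T.depth_child i
  rw [h] at this
  simp [depth] at this

/-- At the root, label `0` is the only label, so `T.parent T.root` is the root's sole neighbour: the
vertex from which all excursions of the original problem start. -/
lemma parent_root_ne_root : T.parent T.root ≠ T.root := (T.adj_parent T.root).ne'

lemma parent_parent_root : T.parent (T.parent T.root) = T.root := by
  refine (T.eq_parent_of_depth (T.adj_parent T.root).symm ?_).symm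
  obtain h | h := T.isTree.dist_eq_dist_add_one_of_adj T.root (T.adj_parent T.root)
  · simp at h
  · exact h

/-- `T.Desc c u`: the vertex `u` is `c` or a descendant of `c`. -/
inductive Desc (c : V) : V → Prop
  | refl : Desc c c
  | child {u : V} (i : Fin (T.b u)) : Desc c u → Desc c (T.child u i)

variable {T}

lemma Desc.ne_root {c u : V} (hc : c ≠ T.root) (h : T.Desc c u) : u ≠ T.root := by
  cases h with
  | refl => exact hc
  | child i _ => exact T.child_ne_root i

lemma Desc.trans {a c u : V} (h : T.Desc a c) (h' : T.Desc c u) : T.Desc a u := by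
  induction h' with
  | refl => exact h
  | child i _ ih => exact ih.child i

lemma Desc.depth_le {c u : V} (h : T.Desc c u) : T.depth c ≤ T.depth u := by
  induction h with
  | refl => rfl
  | child i _ ih => rw [T.depth_child]; omega

lemma Desc.parent {c u : V} (h : T.Desc c u) (hu : u ≠ c) : T.Desc c (T.parent u) := by
  cases h with
  | refl => exact absurd rfl hu
  | child i h => rwa [T.parent_child]

/-- Subtrees hanging from the same level are disjoint. This keeps the children of a vertex from
interfering with each other. -/
lemma Desc.eq_of_depth {c c' u : V} (h : T.Desc c u) (h' : T.Desc c' u)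
    (hd : T.depth c = T.depth c') : c = c' := by
  induction h with
  | refl =>
    cases h' with
    | refl => rfl
    | child i h' =>
      have := h'.depth_le
      rw [T.depth_child] at hd
      omega
  | @child u i h ih =>
    refine ih ?_
    have := h'.parent (u := T.child u i) ?_
    · rwa [T.parent_child] at this
    · intro he
      have := h.depth_le
      rw [← he, T.depth_child] at hd
      omega

lemma not_desc_child {v : V} (i : Fin (T.b v)) : ¬ T.Desc (T.child v i) v := fun h => by
  have := h.depth_le
  rw [T.depth_child] at this
  omega

lemma Desc.ne_of_child {v u : V} {i : Fin (T.b v)} (h : T.Desc (T.child v i) u) : u ≠ v := by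
  rintro rfl
  exact not_desc_child i h

lemma not_desc_parent {v : V} (hv : v ≠ T.root) : ¬ T.Desc v (T.parent v) := fun h => by
  have := h.depth_le
  rw [T.depth_parent hv] at this
  omega

lemma Desc.eq_of_child {v u : V} {i j : Fin (T.b v)} (h : T.Desc (T.child v i) u)
    (h' : T.Desc (T.child v j) u) : i = j :=
  T.child_injective v (h.eq_of_depth h' (by rw [T.depth_child, T.depth_child]))

end Structure

/-! ### Rotor walk up to the first hit of a vertex. -/

section FirstPassage

/-- The rotor walk started from the state `x` hits the vertex `a`. -/
def Hits (a : V) (x : V × T.RotorConfig) : Prop := ∃ t, (T.step^[t] x).1 = a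

open Classical in
/-- The rotors at the time when the rotor walk from the state `x` hits `a`, and their eventual
positions if it never does. -/
noncomputable def final (a : V) (x : V × T.RotorConfig) : T.RotorConfig :=
  if h : T.Hits a x then (T.step^[Nat.find h] x).2
  else fun v => Classical.epsilon fun k => ∀ᶠ t in atTop, (T.step^[t] x).2 v = k

variable {T}

lemma hits_step {a : V} {x : V × T.RotorConfig} (hx : x.1 ≠ a) :
    T.Hits a (T.step x) ↔ T.Hits a x := by
  constructor
  · rintro ⟨t, ht⟩
    exact ⟨t + 1, ht⟩
  · rintro ⟨t, ht⟩
    cases t with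
    | zero => exact absurd ht hx
    | succ t => exact ⟨t, ht⟩

lemma final_of_eq {x : V × T.RotorConfig} {a : V} (hx : x.1 = a) : T.final a x = x.2 := by
  classical
  have h : T.Hits a x := ⟨0, hx⟩
  rw [final, dif_pos h, (Nat.find_eq_zero h).2 hx]
  rfl

lemma final_step {a : V} {x : V × T.RotorConfig} (hx : x.1 ≠ a) :
    T.final a (T.step x) = T.final a x := by
  classical
  by_cases h : T.Hits a x
  · have h' := (hits_step hx).2 h
    have : Nat.find h = Nat.find h' + 1 := by
      exact Nat.find_comp_succ h h' hx
    rw [final, final, dif_pos h, dif_pos h', this]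
    rfl
  · have h' := fun g => h ((hits_step hx).1 g)
    rw [final, final, dif_neg h, dif_neg h']
    funext v
    congr 1
    funext k
    -- Without a hit, only eventual rotor values matter, and these ignore a shift of time by one.
    conv_rhs => rw [← map_add_atTop_eq_nat 1]
    rfl

lemma hits_iterate_step {a : V} {x : V × T.RotorConfig} {t : ℕ}
    (h : ∀ s < t, (T.step^[s] x).1 ≠ a) : T.Hits a (T.step^[t] x) ↔ T.Hits a x := by
  induction t with
  | zero => rfl
  | succ t ih =>
    rw [Function.iterate_succ_apply', hits_step (h t (by omega)), ih fun s hs => h s (by omega)]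

lemma final_iterate_step {a : V} {x : V × T.RotorConfig} {t : ℕ}
    (h : ∀ s < t, (T.step^[s] x).1 ≠ a) : T.final a (T.step^[t] x) = T.final a x := by
  induction t with
  | zero => rfl
  | succ t ih =>
    rw [Function.iterate_succ_apply', final_step (h t (by omega)), ih fun s hs => h s (by omega)]

open Classical in
lemma step_last {v : V} {r : T.RotorConfig} (h : r v = Fin.last _) :
    T.step (v, r) = (T.parent v, Function.update r v 0) := by
  simp only [step, h, Fin.last_add_one, parent]

open Classical in
lemma step_castSucc {v : V} {r : T.RotorConfig} {i : Fin (T.b v)} (h : r v = i.castSucc) :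
    T.step (v, r) = (T.child v i, Function.update r v i.succ) := by
  simp only [step, h, Fin.coeSucc_eq_succ, child]

end FirstPassage

end RotorTree

namespace RotorTree

variable {V : Type*} (T : RotorTree V)

/-! ### Excursions from a vertex to its parent: locality and decomposition. -/

section Excursion

/-- The particle started at `v` eventually moves to the parent of `v`. -/
def ExcursionReturns (v : V) (r : T.RotorConfig) : Prop := T.Hits (T.parent v) (v, r)

/-- The rotors after an excursion of the particle from `v`, until it moves to the parent of `v`. -/
noncomputable def afterExcursion (v : V) (r : T.RotorConfig) : T.RotorConfig :=
  T.final (T.parent v) (v, r)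

open Classical in
/-- The number of excursions from `v`, among `n` run successively, that never end. -/
noncomputable def excursionEscapes (v : V) (r : T.RotorConfig) (n : ℕ) : ℕ :=
  ((Finset.range n).filter fun i => ¬ T.ExcursionReturns v ((T.afterExcursion v)^[i] r)).card

variable {T}

@[simp]
lemma excursionEscapes_zero (v : V) (r : T.RotorConfig) : T.excursionEscapes v r 0 = 0 := by
  simp [excursionEscapes]

open Classical in
lemma excursionEscapes_succ (v : V) (r : T.RotorConfig) (n : ℕ) :
    T.excursionEscapes v r (n + 1) = T.excursionEscapes v r n +
      if T.ExcursionReturns v ((T.afterExcursion v)^[n] r) then 0 else 1 := by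
  rw [excursionEscapes, excursionEscapes, Finset.range_add_one, Finset.filter_insert]
  split_ifs <;> simp

lemma excursionEscapes_mono (v : V) (r : T.RotorConfig) : Monotone (T.excursionEscapes v r) :=
  monotone_nat_of_le_succ fun n => by rw [excursionEscapes_succ]; omega

lemma excursionEscapes_le (v : V) (r : T.RotorConfig) (n : ℕ) : T.excursionEscapes v r n ≤ n := by
  classical
  exact (Finset.card_filter_le _ _).trans (Finset.card_range n).le

lemma step_agree {v : V} {x x' : V × T.RotorConfig} (hx : T.Desc v x.1)
    (h1 : x'.1 = x.1) (h2 : ∀ u, T.Desc v u → x'.2 u = x.2 u) :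
    (T.step x').1 = (T.step x).1 ∧ ∀ u, T.Desc v u → (T.step x').2 u = (T.step x).2 u := by
  classical
  obtain ⟨a, r⟩ := x
  obtain ⟨a', r'⟩ := x'
  obtain rfl : a' = a := h1
  have := h2 a' hx
  dsimp only at this h2
  refine ⟨by simp only [step, this], fun u hu => ?_⟩
  simp only [step, this]
  by_cases hua : u = a'
  · subst hua; simp
  · rw [Function.update_of_ne hua, Function.update_of_ne hua, h2 u hu]

lemma step_fst_desc {v : V} {x : V × T.RotorConfig} (hx : T.Desc v x.1) :
    (T.step x).1 = T.parent v ∨ T.Desc v (T.step x).1 := by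
  obtain ⟨a, r⟩ := x
  obtain h | ⟨i, h⟩ : r a = Fin.last _ ∨ ∃ i : Fin (T.b a), r a = i.castSucc := by
    obtain ⟨i, h⟩ | h := (r a).eq_castSucc_or_eq_last
    exacts [.inr ⟨i, h⟩, .inl h]
  · rw [step_last h]
    by_cases hav : a = v
    · exact .inl (by rw [hav])
    · exact .inr (hx.parent hav)
  · rw [step_castSucc h]
    exact .inr (hx.child i)

lemma step_snd_of_not_desc {v u : V} {x : V × T.RotorConfig} (hx : T.Desc v x.1)
    (hu : ¬ T.Desc v u) : (T.step x).2 u = x.2 u := by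
  classical
  have hne : u ≠ x.1 := by
    rintro rfl
    exact hu hx
  exact Function.update_of_ne hne _ _

lemma iterate_step_fst_desc {v : V} (r : T.RotorConfig) {t : ℕ}
    (ht : ∀ s < t, (T.step^[s] (v, r)).1 ≠ T.parent v) :
    (T.step^[t] (v, r)).1 = T.parent v ∨ T.Desc v (T.step^[t] (v, r)).1 := by
  induction t with
  | zero => exact .inr .refl
  | succ t ih =>
    rw [Function.iterate_succ_apply']
    exact step_fst_desc ((ih fun s hs => ht s (by omega)).resolve_left (ht t (by omega)))

lemma iterate_step_snd_of_not_desc {v u : V} (r : T.RotorConfig) {t : ℕ}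
    (ht : ∀ s < t, (T.step^[s] (v, r)).1 ≠ T.parent v) (hu : ¬ T.Desc v u) :
    (T.step^[t] (v, r)).2 u = r u := by
  induction t with
  | zero => rfl
  | succ t ih =>
    rw [Function.iterate_succ_apply', ← ih fun s hs => ht s (by omega)]
    exact step_snd_of_not_desc ((iterate_step_fst_desc r fun s hs => ht s (by omega)).resolve_left
      (ht t (by omega))) hu

/-- Before reaching the parent the particle stays in the subtree below v, so rotors elsewhere cannot
influence it. -/
lemma iterate_step_agree {v : V} {r r' : T.RotorConfig} (h : ∀ u, T.Desc v u → r' u = r u) {t : ℕ}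
    (ht : ∀ s < t, (T.step^[s] (v, r)).1 ≠ T.parent v) :
    (T.step^[t] (v, r')).1 = (T.step^[t] (v, r)).1 ∧
      ∀ u, T.Desc v u → (T.step^[t] (v, r')).2 u = (T.step^[t] (v, r)).2 u := by
  induction t with
  | zero => exact ⟨rfl, h⟩
  | succ t ih =>
    have ih := ih fun s hs => ht s (by omega)
    rw [Function.iterate_succ_apply', Function.iterate_succ_apply']
    exact step_agree ((iterate_step_fst_desc r fun s hs => ht s (by omega)).resolve_left
      (ht t (by omega))) ih.1 ih.2

/-- A returning excursion splits off the first time at which the parent is reached. -/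
lemma ExcursionReturns.exists_time {v : V} {r : T.RotorConfig} (h : T.ExcursionReturns v r) :
    ∃ t, (∀ s < t, (T.step^[s] (v, r)).1 ≠ T.parent v) ∧
      T.step^[t] (v, r) = (T.parent v, T.afterExcursion v r) := by
  classical
  have ht : ∀ s < Nat.find h, (T.step^[s] (v, r)).1 ≠ T.parent v := fun s hs => Nat.find_min h hs
  refine ⟨Nat.find h, ht, Prod.ext (Nat.find_spec h) ?_⟩
  rw [afterExcursion, ← final_iterate_step ht, final_of_eq (Nat.find_spec h)]

lemma forall_ne_of_not_returns {v : V} {r : T.RotorConfig} (h : ¬ T.ExcursionReturns v r) (t : ℕ) :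
    (T.step^[t] (v, r)).1 ≠ T.parent v := fun ht => h ⟨t, ht⟩

lemma ExcursionReturns.congr {v : V} {r r' : T.RotorConfig} (h : ∀ u, T.Desc v u → r' u = r u)
    (hr : T.ExcursionReturns v r) : T.ExcursionReturns v r' := by
  obtain ⟨t, ht, he⟩ := hr.exists_time
  exact ⟨t, by rw [(iterate_step_agree h ht).1, he]⟩

lemma excursionReturns_congr {v : V} {r r' : T.RotorConfig} (h : ∀ u, T.Desc v u → r' u = r u) :
    T.ExcursionReturns v r' ↔ T.ExcursionReturns v r :=
  ⟨fun g => g.congr fun u hu => (h u hu).symm, fun g => g.congr h⟩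

lemma afterExcursion_congr {v u : V} {r r' : T.RotorConfig} (h : ∀ u, T.Desc v u → r' u = r u)
    (hu : T.Desc v u) : T.afterExcursion v r' u = T.afterExcursion v r u := by
  by_cases hr : T.ExcursionReturns v r
  · obtain ⟨t, ht, he⟩ := hr.exists_time
    have ha := iterate_step_agree h ht
    have ht' : ∀ s < t, (T.step^[s] (v, r')).1 ≠ T.parent v := fun s hs => by
      rw [(iterate_step_agree h fun q hq => ht q (by omega)).1]
      exact ht s hs
    rw [afterExcursion, ← final_iterate_step ht', final_of_eq (by rw [ha.1, he]), ha.2 u hu, he]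
  · have hr' := fun g => hr ((excursionReturns_congr h).1 g)
    rw [ExcursionReturns] at hr hr'
    rw [afterExcursion, afterExcursion, final, final, dif_neg hr, dif_neg hr']
    congr 1
    funext k
    simp_rw [(iterate_step_agree h fun s _ => forall_ne_of_not_returns hr s).2 u hu]

lemma afterExcursion_of_not_desc {v u : V} {r : T.RotorConfig} (hu : ¬ T.Desc v u) :
    T.afterExcursion v r u = r u := by
  by_cases hr : T.ExcursionReturns v r
  · obtain ⟨t, ht, he⟩ := hr.exists_time
    have := iterate_step_snd_of_not_desc r ht hu
    rwa [he] at this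
  · have hc := fun t => iterate_step_snd_of_not_desc r
      (fun s (_ : s < t) => forall_ne_of_not_returns hr s) hu
    rw [ExcursionReturns] at hr
    rw [afterExcursion, final, dif_neg hr]
    simp_rw [hc, eventually_const]
    exact (Classical.epsilon_spec (p := fun k => r u = k) ⟨_, rfl⟩).symm

open Classical in
lemma excursion_of_last {v : V} {r : T.RotorConfig} (h : r v = Fin.last _) :
    T.ExcursionReturns v r ∧ T.afterExcursion v r = Function.update r v 0 := by
  have hv : (v, r).1 ≠ T.parent v := (T.adj_parent v).ne
  rw [ExcursionReturns, afterExcursion, ← final_step hv, ← hits_step hv, step_last h]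
  exact ⟨⟨0, rfl⟩, final_of_eq rfl⟩

lemma ne_parent_of_desc {v u : V} (hv : v ≠ T.root) (h : T.Desc v u) : u ≠ T.parent v :=
  fun he => not_desc_parent hv (he ▸ h)

lemma ne_parent_of_child_excursion {v : V} (hv : v ≠ T.root) {i : Fin (T.b v)}
    {r : T.RotorConfig} {t : ℕ}
    (ht : ∀ s < t, (T.step^[s] (T.child v i, r)).1 ≠ T.parent (T.child v i)) :
    (T.step^[t] (T.child v i, r)).1 ≠ T.parent v := by
  obtain h | h := iterate_step_fst_desc r ht
  · rw [h, T.parent_child]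
    exact (T.adj_parent v).ne
  · exact ne_parent_of_desc hv ((Desc.refl.child i).trans h)

open Classical in
-- A child excursion that never ends stays below the child, so it is the whole remainder of the
-- excursion from v, with the same eventual rotors.
lemma excursion_of_child_escapes {v : V} (hv : v ≠ T.root) {r : T.RotorConfig} {i : Fin (T.b v)}
    (h : r v = i.castSucc) (hi : ¬ T.ExcursionReturns (T.child v i) (Function.update r v i.succ)) :
    ¬ T.ExcursionReturns v r ∧
      T.afterExcursion v r = T.afterExcursion (T.child v i) (Function.update r v i.succ) := by
  have hv' : (v, r).1 ≠ T.parent v := (T.adj_parent v).ne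
  have hne : ¬ T.Hits (T.parent v) (T.child v i, Function.update r v i.succ) := by
    rintro ⟨t, ht⟩
    exact ne_parent_of_child_excursion hv (fun s _ => forall_ne_of_not_returns hi s) ht
  rw [ExcursionReturns, afterExcursion, ← final_step hv', ← hits_step hv', step_castSucc h]
  refine ⟨hne, ?_⟩
  rw [ExcursionReturns] at hi
  rw [afterExcursion, final, final, dif_neg hne, dif_neg hi]

open Classical in
-- When the child excursion ends, the particle is back at v without having met the parent of v, so
-- the rest is again an excursion from v.
lemma excursion_of_child_returns {v : V} (hv : v ≠ T.root) {r : T.RotorConfig} {i : Fin (T.b v)}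
    (h : r v = i.castSucc) (hi : T.ExcursionReturns (T.child v i) (Function.update r v i.succ)) :
    (T.ExcursionReturns v r ↔ T.ExcursionReturns v
        (T.afterExcursion (T.child v i) (Function.update r v i.succ))) ∧
      T.afterExcursion v r = T.afterExcursion v
        (T.afterExcursion (T.child v i) (Function.update r v i.succ)) := by
  have hv' : (v, r).1 ≠ T.parent v := (T.adj_parent v).ne
  obtain ⟨t, ht, he⟩ := hi.exists_time
  have hne : ∀ s < t, (T.step^[s] (T.child v i, Function.update r v i.succ)).1 ≠ T.parent v :=
    fun s hs => ne_parent_of_child_excursion hv fun q hq => ht q (by omega)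
  rw [T.parent_child] at he
  rw [ExcursionReturns, afterExcursion.eq_def T v r, ← final_step hv', ← hits_step hv',
    step_castSucc h, ← final_iterate_step hne, ← hits_iterate_step hne, he]
  exact ⟨Iff.rfl, rfl⟩

end Excursion

/-! ### Escape numbers of a vertex in terms of those of its children. -/

section Recursion

variable {T}

/-- The state of the subtree below `v`, seen from its initial configuration `r`: the rotor at `v`
has passed `k` times through the label `0` and `m i` times through the label of the `i`-th child,
and every child has been served accordingly. -/
structure Served (v : V) (r : T.RotorConfig) (σ : T.RotorConfig) (k : ℕ) (m : Fin (T.b v) → ℕ) :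
    Prop where
  agree : ∀ i u, T.Desc (T.child v i) u → σ u = (T.afterExcursion (T.child v i))^[m i] r u
  count : ∀ i : Fin (T.b v), (m i + if (i : ℕ) < r v then 1 else 0) =
    k + if (i : ℕ) < σ v then 1 else 0

open Classical in
-- The turn of the rotor at v and the excursion from child i leave the other children's subtrees
-- alone, so only `m i` advances.
lemma Served.serve_child {v : V} {r σ : T.RotorConfig} {k : ℕ} {m : Fin (T.b v) → ℕ}
    (h : Served v r σ k m) {i : Fin (T.b v)} (hi : σ v = i.castSucc) :
    Served v r (T.afterExcursion (T.child v i) (Function.update σ v i.succ)) k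
      (Function.update m i (m i + 1)) := by
  have hup : ∀ j u, T.Desc (T.child v j) u → Function.update σ v i.succ u = σ u := fun j u hu =>
    Function.update_of_ne hu.ne_of_child _ _
  constructor
  · intro j u hu
    by_cases hj : j = i
    · subst hj
      rw [Function.update_self, Function.iterate_succ_apply']
      exact afterExcursion_congr (fun w hw => by rw [hup j w hw, h.agree j w hw]) hu
    · rw [Function.update_of_ne hj, afterExcursion_of_not_desc (fun h' => hj (hu.eq_of_child h')),
        hup j u hu, h.agree j u hu]
  · intro j
    have := h.count j
    rw [afterExcursion_of_not_desc (not_desc_child i), Function.update_self]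
    rw [hi] at this
    by_cases hj : j = i
    · subst hj
      simp at this ⊢
      omega
    · have hj' : (j : ℕ) ≠ i := fun h => hj (Fin.ext h)
      rw [Function.update_of_ne hj, this]
      have : (j : ℕ) < i ↔ (j : ℕ) < i + 1 := by omega
      simp [this]

open Classical in
lemma Served.serve_parent {v : V} {r σ : T.RotorConfig} {k : ℕ} {m : Fin (T.b v) → ℕ}
    (h : Served v r σ k m) (hi : σ v = Fin.last _) :
    Served v r (Function.update σ v 0) (k + 1) m := by
  constructor
  · intro j u hu
    rw [Function.update_of_ne hu.ne_of_child, h.agree j u hu]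
  · intro j
    have := h.count j
    rw [hi] at this
    simpa using this

open Classical in
-- Within one excursion the rotor at v serves child after child until one of them swallows the
-- particle or the parent's turn comes. The induction is on the number of children still ahead of
-- the rotor.
lemma Served.excursion {v : V} (hv : v ≠ T.root) {r σ : T.RotorConfig} {k : ℕ}
    {m : Fin (T.b v) → ℕ} (h : Served v r σ k m) :
    ∃ k' m', Served v r (T.afterExcursion v σ) k' m' ∧
      k' + ∑ i, T.excursionEscapes (T.child v i) r (m' i) =
        k + ∑ i, T.excursionEscapes (T.child v i) r (m i) + 1 ∧
      ∑ i, T.excursionEscapes (T.child v i) r (m' i) =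
        ∑ i, T.excursionEscapes (T.child v i) r (m i) +
          if T.ExcursionReturns v σ then 0 else 1 := by
  induction hd : T.b v - (σ v : ℕ) generalizing σ m with
  | zero =>
    have hl : σ v = Fin.last _ := Fin.ext (by have := (σ v).is_lt; simp; omega)
    obtain ⟨h1, h2⟩ := excursion_of_last hl
    refine ⟨k + 1, m, h2 ▸ h.serve_parent hl, by omega, by simp [h1]⟩
  | succ d ih =>
    let i : Fin (T.b v) := ⟨σ v, by omega⟩
    have hi : σ v = i.castSucc := Fin.ext rfl
    have hs := h.serve_child hi
    have hret : T.ExcursionReturns (T.child v i) (Function.update σ v i.succ) ↔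
        T.ExcursionReturns (T.child v i) ((T.afterExcursion (T.child v i))^[m i] r) :=
      excursionReturns_congr fun u hu => by
        rw [Function.update_of_ne hu.ne_of_child, h.agree i u hu]
    have hsum : ∑ j, T.excursionEscapes (T.child v j) r (Function.update m i (m i + 1) j) =
        ∑ j, T.excursionEscapes (T.child v j) r (m j) +
          if T.ExcursionReturns (T.child v i) (Function.update σ v i.succ) then 0 else 1 := by
      rw [← Finset.add_sum_erase _ _ (Finset.mem_univ i),
        ← Finset.add_sum_erase _ (fun j => T.excursionEscapes (T.child v j) r (m j))
          (Finset.mem_univ i), Function.update_self, excursionEscapes_succ]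
      simp only [hret]
      rw [Finset.sum_congr rfl fun j hj => by
        rw [Function.update_of_ne (Finset.ne_of_mem_erase hj)]]
      omega
    by_cases hr : T.ExcursionReturns (T.child v i) (Function.update σ v i.succ)
    · obtain ⟨h1, h2⟩ := excursion_of_child_returns hv hi hr
      rw [h2, h1]
      rw [if_pos hr, add_zero] at hsum
      rw [← hsum]
      refine ih hs ?_
      rw [afterExcursion_of_not_desc (not_desc_child i), Function.update_self]
      simp [i]
      omega
    · obtain ⟨h1, h2⟩ := excursion_of_child_escapes hv hi hr
      rw [if_neg hr] at hsum
      exact ⟨k, _, h2 ▸ hs, by rw [hsum]; omega, by rw [hsum, if_neg h1]⟩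

lemma served_iterate {v : V} (hv : v ≠ T.root) (r : T.RotorConfig) (n : ℕ) :
    ∃ k m, Served v r ((T.afterExcursion v)^[n] r) k m ∧
      k + ∑ i, T.excursionEscapes (T.child v i) r (m i) = n ∧
      ∑ i, T.excursionEscapes (T.child v i) r (m i) = T.excursionEscapes v r n := by
  induction n with
  | zero => exact ⟨0, fun _ => 0, ⟨fun _ _ _ => rfl, fun _ => rfl⟩, by simp, by simp⟩
  | succ n ih =>
    obtain ⟨k, m, h, h1, h2⟩ := ih
    obtain ⟨k', m', h', h1', h2'⟩ := h.excursion hv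
    rw [Function.iterate_succ_apply']
    exact ⟨k', m', h', by omega, by rw [h2', h2, excursionEscapes_succ]⟩

/-- Of `n` excursions from `v`, `k` return to the parent of `v`, and the others escape through the
children of `v`, the `i`-th of which is visited `m i` times. -/
lemma exists_excursionEscapes_eq_sum {v : V} (hv : v ≠ T.root) (r : T.RotorConfig) (n : ℕ) :
    ∃ k, ∃ m : Fin (T.b v) → ℕ, n = k + T.excursionEscapes v r n ∧
      T.excursionEscapes v r n = ∑ i, T.excursionEscapes (T.child v i) r (m i) ∧
      (∀ i, m i ≤ k + 1) ∧ (∀ i, k ≤ m i + 1) ∧ ∀ i : Fin (T.b v), (r v : ℕ) ≤ i → k ≤ m i := by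
  obtain ⟨k, m, h, h1, h2⟩ := served_iterate hv r n
  -- Child i has label i + 1, so the indicators in `count` record whether the rotor is already past
  -- it. If `r v ≤ i`, the initial indicator is zero and child i cannot lag behind k.
  refine ⟨k, m, by omega, h2.symm, fun i => ?_, fun i => ?_, fun i hi => ?_⟩ <;>
    have := h.count i <;> split_ifs at this <;> omega

end Recursion

/-! ### Subtrees with no rotor in its last position. -/

section Fresh

variable {T}

/-- If no rotor below `v` is about to point to the parent, then the particle moves away from the
root for ever. -/
lemma not_excursionReturns_of_forall_lt {v : V} (hv : v ≠ T.root) {r : T.RotorConfig}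
    (hr : ∀ u, T.Desc v u → (r u : ℕ) < T.b u) : ¬ T.ExcursionReturns v r := by
  classical
  -- Invariant: the particle has only moved downwards, so every rotor at or below its location is
  -- still in its initial position.
  have key : ∀ t, T.Desc v (T.step^[t] (v, r)).1 ∧
      ∀ u, T.Desc (T.step^[t] (v, r)).1 u → (T.step^[t] (v, r)).2 u = r u := by
    intro t
    induction t with
    | zero => exact ⟨.refl, fun _ _ => rfl⟩
    | succ t ih =>
      rw [Function.iterate_succ_apply']
      generalize T.step^[t] (v, r) = x at ih
      obtain ⟨a, σ⟩ := x
      have hσ : σ a = r a := ih.2 a .refl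
      let i : Fin (T.b a) := ⟨σ a, by rw [hσ]; exact hr a ih.1⟩
      rw [step_castSucc (i := i) (Fin.ext rfl)]
      refine ⟨ih.1.child i, fun u hu => ?_⟩
      dsimp only at hu ⊢
      rw [Function.update_of_ne hu.ne_of_child]
      exact ih.2 u ((Desc.refl.child i).trans hu)
  rintro ⟨t, ht⟩
  exact ne_parent_of_desc hv (key t).1 ht

lemma one_le_excursionEscapes {v : V} (hv : v ≠ T.root) {r : T.RotorConfig}
    (hr : ∀ u, T.Desc v u → (r u : ℕ) < T.b u) {n : ℕ} (hn : 1 ≤ n) :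
    1 ≤ T.excursionEscapes v r n := by
  refine le_trans ?_ (excursionEscapes_mono v r hn)
  have h := not_excursionReturns_of_forall_lt hv hr
  rw [excursionEscapes_succ, Function.iterate_zero_apply, if_neg h]
  omega

end Fresh

end RotorTree

namespace RotorTree

variable {V : Type*} (T : RotorTree V)

/-! ### The escape probability of random walk as a limit of a recursion. -/

section LevelProb

/-- The probability that simple random walk from `v` gets `h` levels below `v` before it moves to
the parent of `v`, computed by decomposition into excursions through the children. -/
noncomputable def levelProb : ℕ → V → ℝ
  | 0, _ => 1
  | h + 1, v => (∑ i, levelProb h (T.child v i)) / (1 + ∑ i, levelProb h (T.child v i))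

/-- The limit of `levelProb`, which decreases with the level. -/
noncomputable def limitProb (v : V) : ℝ := ⨅ h, T.levelProb h v

variable {T}

lemma div_one_add_mono {x y : ℝ} (hx : 0 ≤ x) (hxy : x ≤ y) : x / (1 + x) ≤ y / (1 + y) := by
  rw [div_le_div_iff₀ (by linarith) (by linarith)]
  nlinarith

lemma levelProb_nonneg (h : ℕ) (v : V) : 0 ≤ T.levelProb h v := by
  induction h generalizing v with
  | zero => exact zero_le_one
  | succ h ih =>
    have := Finset.sum_nonneg fun i (_ : i ∈ Finset.univ) => ih (T.child v i)
    rw [levelProb]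
    positivity

lemma levelProb_le_one (h : ℕ) (v : V) : T.levelProb h v ≤ 1 := by
  cases h with
  | zero => exact le_rfl
  | succ h =>
    have := Finset.sum_nonneg fun i (_ : i ∈ Finset.univ) => levelProb_nonneg (T := T) h (T.child v i)
    rw [levelProb, div_le_one (by positivity)]
    linarith

lemma levelProb_succ_le (h : ℕ) (v : V) : T.levelProb (h + 1) v ≤ T.levelProb h v := by
  induction h generalizing v with
  | zero => exact levelProb_le_one _ _
  | succ h ih =>
    rw [levelProb, levelProb]
    exact div_one_add_mono (Finset.sum_nonneg fun i _ => levelProb_nonneg _ _)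
      (Finset.sum_le_sum fun i _ => ih _)

lemma tendsto_levelProb (v : V) :
    Tendsto (fun h => T.levelProb h v) atTop (𝓝 (T.limitProb v)) :=
  tendsto_atTop_ciInf (antitone_nat_of_succ_le fun h => levelProb_succ_le h v)
    ⟨0, by rintro _ ⟨h, rfl⟩; exact levelProb_nonneg h v⟩

lemma limitProb_nonneg (v : V) : 0 ≤ T.limitProb v :=
  ge_of_tendsto' (tendsto_levelProb v) fun h => levelProb_nonneg h v

lemma limitProb_le_one (v : V) : T.limitProb v ≤ 1 :=
  le_of_tendsto' (tendsto_levelProb v) fun h => levelProb_le_one h v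

lemma sum_limitProb_nonneg (v : V) : 0 ≤ ∑ i, T.limitProb (T.child v i) :=
  Finset.sum_nonneg fun _ _ => limitProb_nonneg _

lemma limitProb_eq (v : V) : T.limitProb v =
    (∑ i, T.limitProb (T.child v i)) / (1 + ∑ i, T.limitProb (T.child v i)) := by
  have hs : Tendsto (fun h => ∑ i, T.levelProb h (T.child v i)) atTop
      (𝓝 (∑ i, T.limitProb (T.child v i))) :=
    tendsto_finsetSum _ fun i _ => tendsto_levelProb _
  have hpos : 1 + ∑ i, T.limitProb (T.child v i) ≠ 0 := by
    have := sum_limitProb_nonneg (T := T) v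
    positivity
  exact tendsto_nhds_unique ((tendsto_add_atTop_iff_nat 1).2 (tendsto_levelProb v))
    (hs.div (hs.const_add 1) hpos)

end LevelProb

/-! ### Linear upper and lower bounds for the escape numbers. -/

section Bounds

variable {T}

/-- Turns the error relative to n into the error relative to k, which is what the children's bounds
control. The factor 1/(1+s) is at most one, so errors are not amplified on the way up. -/
lemma sub_div_one_add_mul {s k e n : ℝ} (hs : 0 ≤ s) (hn : n = k + e) :
    e - s / (1 + s) * n = (e - s * k) / (1 + s) := by
  subst hn
  field_simp
  ring

/-- Each child contributes at most p_i (k+1) + C_i, and the extra p_i + C_i goes into the constant.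
The constant depends on h, but h is fixed before n tends to infinity. -/
lemma exists_excursionEscapes_le (h : ℕ) {v : V} (hv : v ≠ T.root) (r : T.RotorConfig) :
    ∃ C : ℝ, ∀ n : ℕ, (T.excursionEscapes v r n : ℝ) ≤ T.levelProb h v * n + C := by
  induction h generalizing v with
  | zero =>
    refine ⟨0, fun n => ?_⟩
    simpa [levelProb] using excursionEscapes_le v r n
  | succ h ih =>
    choose C hC using fun i => ih (T.child_ne_root (v := v) i)
    have hS : 0 ≤ ∑ i, T.levelProb h (T.child v i) :=
      Finset.sum_nonneg fun i _ => levelProb_nonneg _ _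
    refine ⟨(∑ i, (T.levelProb h (T.child v i) + C i)) /
      (1 + ∑ i, T.levelProb h (T.child v i)), fun n => ?_⟩
    obtain ⟨k, m, hn, he, hm, -⟩ := exists_excursionEscapes_eq_sum hv r n
    have hnR : (n : ℝ) = k + T.excursionEscapes v r n := by exact_mod_cast hn
    rw [← sub_le_iff_le_add', levelProb, sub_div_one_add_mul hS hnR]
    gcongr
    rw [he, Finset.sum_mul, Nat.cast_sum, ← Finset.sum_sub_distrib]
    refine Finset.sum_le_sum fun i _ => ?_
    have h1 := hC i (m i)
    have h2 : (m i : ℝ) ≤ k + 1 := by exact_mod_cast hm i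
    nlinarith [levelProb_nonneg (T := T) h (T.child v i)]

/-- Strong induction on n with the potential min(E, M) + n/M. A child that lags behind by one visit
creates an error of one unit, which must be paid by a drop of the potential between v and that
child. The bound is useful because min(E, M) ≤ M is bounded and n/M has small slope. -/
lemma limitProb_mul_sub_le_of_forall_lt {r : T.RotorConfig} {M : ℕ} (hM : 1 ≤ M) (n : ℕ) {v : V}
    (hv : v ≠ T.root) (hr : ∀ u, T.Desc v u → (r u : ℕ) < T.b u) :
    T.limitProb v * n - T.excursionEscapes v r n ≤
      T.limitProb v * (min (T.excursionEscapes v r n : ℝ) M + n / M) := by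
  induction n using Nat.strong_induction_on generalizing v with
  | _ n ih =>
  obtain ⟨k, m, hn, he, -, hk, hk'⟩ := exists_excursionEscapes_eq_sum hv r n
  set E := T.excursionEscapes v r n with hE
  have hM' : (1 : ℝ) ≤ M := by exact_mod_cast hM
  have hnR : (n : ℝ) = k + E := by exact_mod_cast hn
  -- If k = 0 then E = n and there is nothing to lose. Otherwise the last child has been visited.
  obtain rfl | hk0 := Nat.eq_zero_or_pos k
  · have h1 : T.limitProb v * n ≤ E := by
      rw [hnR]
      simpa using mul_le_mul_of_nonneg_right (limitProb_le_one v) (Nat.cast_nonneg (α := ℝ) E)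
    have h2 : 0 ≤ T.limitProb v * (min (E : ℝ) M + n / M) :=
      mul_nonneg (limitProb_nonneg v) (by positivity)
    linarith
  have hS := sum_limitProb_nonneg (T := T) v
  have hb : (r v : ℕ) < T.b v := hr v .refl
  have hrc : ∀ i u, T.Desc (T.child v i) u → (r u : ℕ) < T.b u := fun i u hu =>
    hr u ((Desc.refl.child i).trans hu)
  -- The last child l never lags, since `r v < b v`; so it is visited at least k ≥ 1 times and
  -- accounts for an escape. Every other child then has at most E - 1 escapes.
  let l : Fin (T.b v) := ⟨T.b v - 1, by omega⟩
  have hl : 1 ≤ T.excursionEscapes (T.child v l) r (m l) :=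
    one_le_excursionEscapes (T.child_ne_root l) (hrc l)
      (hk0.trans_le (hk' l (by simp only [l]; omega)))
  have hle : ∀ i, T.excursionEscapes (T.child v i) r (m i) ≤ E := fun i => by
    rw [he]
    exact Finset.single_le_sum (f := fun i => T.excursionEscapes (T.child v i) r (m i))
      (fun _ _ => Nat.zero_le _) (Finset.mem_univ i)
  have hlt : ∀ i, i ≠ l → T.excursionEscapes (T.child v i) r (m i) + 1 ≤ E := fun i hi => by
    have := Finset.sum_le_sum_of_subset (f := fun i => T.excursionEscapes (T.child v i) r (m i))
      (Finset.subset_univ {i, l})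
    rw [Finset.sum_pair hi, ← he] at this
    omega
  have key : ∀ i, T.limitProb (T.child v i) * k - T.excursionEscapes (T.child v i) r (m i) ≤
      T.limitProb (T.child v i) * (min (E : ℝ) M + n / M) := by
    intro i
    have hmono := excursionEscapes_mono (T.child v i) r (min_le_left (m i) k)
    -- Truncation at k gives a visit count below n, because E ≥ 1, and can only lower the number of
    -- escapes.
    have hih := ih (min (m i) k) (by have := hle l; omega) (T.child_ne_root i) (hrc i)
    set m' := min (m i) k with hm'
    set e' := T.excursionEscapes (T.child v i) r m'
    have hmono' : (e' : ℝ) ≤ T.excursionEscapes (T.child v i) r (m i) := by exact_mod_cast hmono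
    have hm'k : (m' : ℝ) ≤ k := by exact_mod_cast min_le_right _ _
    have hmain : (k : ℝ) - m' + (min (e' : ℝ) M + m' / M) ≤ min (E : ℝ) M + n / M := by
      -- In the first case the child does not lag and monotonicity suffices. In the second it may
      -- lag by one: if E ≤ M the term min(E, M) drops by at least one, and if E ≥ M the term n/M
      -- does, as n - k = E.
      by_cases hi : (r v : ℕ) ≤ i
      · have : m' = k := min_eq_right (hk' i hi)
        have h1 : (e' : ℝ) ≤ E := by exact_mod_cast hmono.trans (hle i)
        rw [this, sub_self, zero_add]
        gcongr
        omega
      · have hil : i ≠ l := by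
          rintro rfl
          simp only [l] at hi
          omega
        have h1 : (e' : ℝ) + 1 ≤ E := by exact_mod_cast (Nat.succ_le_succ hmono).trans (hlt i hil)
        have h2 : (k : ℝ) ≤ m' + 1 := by
          have := hk i
          exact_mod_cast (show k ≤ m' + 1 by omega)
        have h3 : (m' : ℝ) / M ≤ k / M := by gcongr
        rw [hnR, add_div]
        obtain hEM | hEM := le_total (E : ℝ) M
        · rw [min_eq_left hEM]
          have : 0 ≤ (E : ℝ) / M := by positivity
          linarith [min_le_left (e' : ℝ) M]
        · rw [min_eq_right hEM]
          have : 1 ≤ (E : ℝ) / M := by rwa [one_le_div (by linarith)]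
          linarith [min_le_right (e' : ℝ) M]
    have := mul_le_mul_of_nonneg_left hmain (limitProb_nonneg (T := T) (T.child v i))
    linarith
  rw [limitProb_eq, ← neg_le_neg_iff, neg_sub, sub_div_one_add_mul hS hnR, ← neg_le_neg_iff,
    neg_neg, ← neg_div, neg_sub, div_mul_eq_mul_div]
  have hsum := Finset.sum_le_sum fun i (_ : i ∈ Finset.univ) => key i
  rw [Finset.sum_sub_distrib, ← Finset.sum_mul, ← Nat.cast_sum, ← he, ← Finset.sum_mul] at hsum
  gcongr

lemma exists_limitProb_mul_sub_le_of_forall_lt {r : T.RotorConfig} {v : V} (hv : v ≠ T.root)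
    (hr : ∀ u, T.Desc v u → (r u : ℕ) < T.b u) {ε : ℝ} (hε : 0 < ε) :
    ∃ C : ℝ, ∀ n : ℕ, T.limitProb v * n - T.excursionEscapes v r n ≤ ε * n + C := by
  obtain ⟨M, hM⟩ := exists_nat_one_div_lt hε
  refine ⟨((M + 1 : ℕ) : ℝ), fun n => ?_⟩
  refine (limitProb_mul_sub_le_of_forall_lt (M := M + 1) (by omega) n hv hr).trans ?_
  have h1 : (n : ℝ) / (M + 1 : ℕ) ≤ ε * n := by
    have := mul_le_mul_of_nonneg_right hM.le (Nat.cast_nonneg (α := ℝ) n)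
    push_cast
    rwa [one_div_mul_eq_div] at this
  refine (mul_le_of_le_one_left (by positivity) (limitProb_le_one v)).trans ?_
  linarith [min_le_right (T.excursionEscapes v r n : ℝ) (M + 1 : ℕ)]

/-- Below depth N the previous bound applies. The induction climbs the j levels above it, where a
lag of one visit per child merely increases the constant. -/
lemma exists_limitProb_mul_sub_le {r : T.RotorConfig} {N : ℕ}
    (hr : ∀ u, u ≠ T.root → N ≤ T.depth u → (r u : ℕ) < T.b u) (j : ℕ) {v : V} (hv : v ≠ T.root)
    (hj : N ≤ T.depth v + j) {ε : ℝ} (hε : 0 < ε) :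
    ∃ C : ℝ, ∀ n : ℕ, T.limitProb v * n - T.excursionEscapes v r n ≤ ε * n + C := by
  induction j generalizing v ε with
  | zero =>
    exact exists_limitProb_mul_sub_le_of_forall_lt hv
      (fun u hu => hr u (hu.ne_root hv) (by have := hu.depth_le; omega)) hε
  | succ j ih =>
    -- The slope errors of the `b v` children must add up to at most ε; the added 1 covers a vertex
    -- without children.
    have hε' : 0 < ε / (T.b v + 1) := by positivity
    choose C hC using fun i => ih (T.child_ne_root (v := v) i)
      (by rw [T.depth_child]; omega) hε'
    have hS := sum_limitProb_nonneg (T := T) v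
    refine ⟨∑ i, (1 + |C i|), fun n => ?_⟩
    obtain ⟨k, m, hn, he, -, hk, -⟩ := exists_excursionEscapes_eq_sum hv r n
    have hnR : (n : ℝ) = k + T.excursionEscapes v r n := by exact_mod_cast hn
    have key : ∀ i, T.limitProb (T.child v i) * k - T.excursionEscapes (T.child v i) r (m i) ≤
        ε / (T.b v + 1) * n + (1 + |C i|) := by
      intro i
      have hmono := excursionEscapes_mono (T.child v i) r (min_le_left (m i) k)
      have hmono' : (T.excursionEscapes (T.child v i) r (min (m i) k) : ℝ) ≤
        T.excursionEscapes (T.child v i) r (m i) := by exact_mod_cast hmono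
      have h1 := hC i (min (m i) k)
      have h2 : (k : ℝ) ≤ (min (m i) k : ℕ) + 1 := by
        have := hk i
        exact_mod_cast (show k ≤ min (m i) k + 1 by omega)
      have h3 : ((min (m i) k : ℕ) : ℝ) ≤ n := by
        exact_mod_cast (min_le_right _ _).trans (by omega)
      have h4 := mul_le_mul_of_nonneg_left h3 hε'.le
      have h5 := mul_le_mul_of_nonneg_left h2 (limitProb_nonneg (T := T) (T.child v i))
      linarith [le_abs_self (C i), limitProb_le_one (T := T) (T.child v i)]
    have hsum := Finset.sum_le_sum fun i (_ : i ∈ Finset.univ) => key i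
    rw [Finset.sum_sub_distrib, ← Finset.sum_mul, ← Nat.cast_sum, ← he, Finset.sum_add_distrib,
      Finset.sum_const, Finset.card_univ, Fintype.card_fin, nsmul_eq_mul] at hsum
    have hb : (T.b v : ℝ) * (ε / (T.b v + 1) * n) ≤ ε * n := by
      rw [← mul_assoc, mul_div_assoc', mul_comm (T.b v : ℝ), mul_div_assoc]
      have : (T.b v : ℝ) / (T.b v + 1) ≤ 1 := by
        rw [div_le_one (by positivity)]
        linarith
      gcongr
      exact mul_le_of_le_one_right hε.le this
    have hC0 : 0 ≤ ∑ i, (1 + |C i|) := Finset.sum_nonneg fun i _ => by positivity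
    rw [limitProb_eq, ← neg_le_neg_iff, neg_sub, sub_div_one_add_mul hS hnR, ← neg_le_neg_iff,
      neg_neg, ← neg_div, neg_sub]
    rw [div_le_iff₀ (by linarith)]
    -- The denominator 1 + S is at least one and the bound is nonnegative, so the division can be
    -- dropped. The absolute values in the constant serve this purpose.
    have : 0 ≤ (ε * n + ∑ i, (1 + |C i|)) * ∑ i, T.limitProb (T.child v i) := by positivity
    linarith

/-- The proportion of escaping excursions converges if only finitely many rotors are about to
point to the parent. -/
lemma tendsto_excursionEscapes_div {r : T.RotorConfig}
    (hr : {v : V | v ≠ T.root ∧ (r v : ℕ) = T.b v}.Finite) {v : V} (hv : v ≠ T.root) :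
    Tendsto (fun n : ℕ => (T.excursionEscapes v r n : ℝ) / n) atTop (𝓝 (T.limitProb v)) := by
  obtain ⟨N, hN⟩ := (hr.image T.depth).bddAbove
  have hr' : ∀ u, u ≠ T.root → N + 1 ≤ T.depth u → (r u : ℕ) < T.b u := fun u hu hd => by
    refine lt_of_le_of_ne (Nat.lt_succ_iff.1 (r u).is_lt) fun he => ?_
    have := hN ⟨u, ⟨hu, he⟩, rfl⟩
    omega
  have hC : ∀ C : ℝ, Tendsto (fun n : ℕ => C / n) atTop (𝓝 0) := fun C =>
    tendsto_const_div_atTop_nhds_zero_nat C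
  rw [tendsto_order]
  constructor
  · intro a ha
    have hε : 0 < (T.limitProb v - a) / 2 := by linarith
    obtain ⟨C, hC'⟩ := exists_limitProb_mul_sub_le hr' (N + 1) hv (by omega) hε
    filter_upwards [(hC C).eventually (gt_mem_nhds hε), eventually_gt_atTop 0] with n h1 h2
    have hn : (0 : ℝ) < n := by exact_mod_cast h2
    have h3 := hC' n
    rw [div_lt_iff₀ hn] at h1
    rw [lt_div_iff₀ hn]
    linarith
  · intro a ha
    obtain ⟨h, hh⟩ := ((tendsto_levelProb v).eventually (gt_mem_nhds ha)).exists
    obtain ⟨C, hC'⟩ := exists_excursionEscapes_le h hv r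
    have hε : 0 < a - T.levelProb h v := by linarith
    filter_upwards [(hC C).eventually (gt_mem_nhds hε), eventually_gt_atTop 0] with n h1 h2
    have hn : (0 : ℝ) < n := by exact_mod_cast h2
    have h3 := hC' n
    rw [div_lt_iff₀ hn] at h1
    rw [div_lt_iff₀ hn]
    linarith

end Bounds

end RotorTree

namespace RotorTree

variable {V : Type*} (T : RotorTree V)

/-! ### From walks started at the root to excursions from its neighbour. -/

section Root

variable {T}

lemma step_root (r : T.RotorConfig) : T.step (T.root, r) = (T.parent T.root, r) := by
  classical
  have : Subsingleton (Fin (T.b T.root + 1)) := by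
    rw [T.b_root]
    exact inferInstanceAs (Subsingleton (Fin 1))
  rw [step_last (Subsingleton.elim _ _), Function.update_eq_self_iff.2 (Subsingleton.elim _ _)]

lemma walk_succ_eq (r : T.RotorConfig) (t : ℕ) :
    T.walk r (t + 1) = T.step^[t] (T.parent T.root, r) := by
  rw [walk, Function.iterate_succ_apply, step_root]

lemma returns_iff (r : T.RotorConfig) :
    T.Returns r ↔ T.ExcursionReturns (T.parent T.root) r := by
  rw [ExcursionReturns, T.parent_parent_root]
  constructor
  · rintro ⟨t, ht, h⟩
    obtain ⟨s, rfl⟩ : ∃ s, t = s + 1 := ⟨t - 1, by omega⟩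
    exact ⟨s, by rwa [walk_succ_eq] at h⟩
  · rintro ⟨s, h⟩
    exact ⟨s + 1, by omega, by rwa [walk_succ_eq]⟩

lemma after_eq : T.after = T.afterExcursion (T.parent T.root) := by
  classical
  funext r
  rw [afterExcursion, T.parent_parent_root]
  by_cases h : T.Returns r
  · obtain ⟨s, hs⟩ : ∃ s, Nat.find h = s + 1 :=
      ⟨Nat.find h - 1, by have := (Nat.find_spec h).1; omega⟩
    have hne : ∀ q < s, (T.step^[q] (T.parent T.root, r)).1 ≠ T.root := fun q hq he =>
      Nat.find_min h (m := q + 1) (by omega) ⟨by omega, by rwa [walk_succ_eq]⟩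
    have heq := (Nat.find_spec h).2
    rw [hs, walk_succ_eq] at heq
    rw [after, dif_pos h, hs, walk_succ_eq, ← final_iterate_step hne, final_of_eq heq]
  · have h' := fun g => h ((returns_iff r).2 g)
    rw [ExcursionReturns, T.parent_parent_root] at h'
    rw [after, final, dif_neg h, dif_neg h']
    funext v
    congr 1
    funext k
    conv_lhs => rw [← map_add_atTop_eq_nat 1]
    simp only [eventually_map, walk_succ_eq]

lemma escapes_eq (r : T.RotorConfig) (n : ℕ) :
    T.escapes r n = T.excursionEscapes (T.parent T.root) r n := by
  classical
  simp only [escapes, excursionEscapes, after_eq, returns_iff]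

end Root

/-! ### Hitting probabilities of the root and their limit. -/

section HitProb

open Classical in
/-- The probability that simple random walk from a given vertex hits the root within the given
time. -/
noncomputable def hitProb : ℕ → V → ℝ
  | 0, x => if x = T.root then 1 else 0
  | t + 1, x => if x = T.root then 1 else (∑ i, hitProb t (T.nbr x i)) / (T.b x + 1)

variable {T}

lemma hitProb_root (t : ℕ) : T.hitProb t T.root = 1 := by
  cases t <;> simp [hitProb]

lemma hitProb_zero_of_ne {v : V} (hv : v ≠ T.root) : T.hitProb 0 v = 0 := by
  rw [hitProb, if_neg hv]

lemma hitProb_succ_of_ne (t : ℕ) {v : V} (hv : v ≠ T.root) :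
    T.hitProb (t + 1) v = (∑ i, T.hitProb t (T.nbr v i)) / (T.b v + 1) := by
  rw [hitProb, if_neg hv]

lemma hitProb_nonneg (t : ℕ) (v : V) : 0 ≤ T.hitProb t v := by
  induction t generalizing v with
  | zero =>
    rw [hitProb]
    split_ifs <;> norm_num
  | succ t ih =>
    rw [hitProb]
    split_ifs
    · norm_num
    · exact div_nonneg (Finset.sum_nonneg fun i _ => ih _) (by positivity)

lemma hitProb_le_one (t : ℕ) (v : V) : T.hitProb t v ≤ 1 := by
  induction t generalizing v with
  | zero =>
    rw [hitProb]
    split_ifs <;> norm_num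
  | succ t ih =>
    rw [hitProb]
    split_ifs
    · rfl
    · rw [div_le_one (by positivity)]
      refine (Finset.sum_le_sum fun i _ => ih _).trans ?_
      simp

lemma hitProb_le_succ (t : ℕ) (v : V) : T.hitProb t v ≤ T.hitProb (t + 1) v := by
  by_cases hv : v = T.root
  · rw [hv, hitProb_root, hitProb_root]
  induction t generalizing v with
  | zero =>
    rw [hitProb_zero_of_ne hv]
    exact hitProb_nonneg _ _
  | succ t ih =>
    rw [hitProb_succ_of_ne _ hv, hitProb_succ_of_ne _ hv]
    gcongr with i
    by_cases hi : (T.nbr v i : V) = T.root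
    · rw [hi, hitProb_root, hitProb_root]
    · exact ih _ hi

lemma hitProb_succ_mul (t : ℕ) {v : V} (hv : v ≠ T.root) : T.hitProb (t + 1) v * (T.b v + 1) =
    T.hitProb t (T.parent v) + ∑ i, T.hitProb t (T.child v i) := by
  rw [hitProb_succ_of_ne t hv, div_mul_cancel₀ _ (by positivity), Fin.sum_univ_succ]
  rfl

lemma one_sub_limitProb (v : V) :
    1 - T.limitProb v = 1 / (1 + ∑ i, T.limitProb (T.child v i)) := by
  have := sum_limitProb_nonneg (T := T) v
  rw [limitProb_eq]
  field_simp
  ring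

/-- Inserting the children's bounds into the one-step equation at v, and using monotonicity in time,
leaves (1 + S) * `hitProb (t + 1) v` ≤ `hitProb t (parent v)`; the factor 1/(1 + S) is `1 -
limitProb v`. -/
lemma hitProb_le (t : ℕ) {v : V} (hv : v ≠ T.root) :
    T.hitProb t v ≤ (1 - T.limitProb v) * T.hitProb t (T.parent v) := by
  induction t generalizing v with
  | zero =>
    rw [hitProb_zero_of_ne hv]
    exact mul_nonneg (by linarith [limitProb_le_one (T := T) v]) (hitProb_nonneg _ _)
  | succ t ih =>
    have hS := sum_limitProb_nonneg (T := T) v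
    have h1 := hitProb_succ_mul t hv
    have h2 : ∑ i, T.hitProb t (T.child v i) ≤
        ∑ i, (1 - T.limitProb (T.child v i)) * T.hitProb (t + 1) v := by
      refine Finset.sum_le_sum fun i _ => (ih (T.child_ne_root i)).trans ?_
      rw [T.parent_child]
      exact mul_le_mul_of_nonneg_left (hitProb_le_succ t v)
        (by linarith [limitProb_le_one (T := T) (T.child v i)])
    rw [← Finset.sum_mul, Finset.sum_sub_distrib, Finset.sum_const, Finset.card_univ,
      Fintype.card_fin, nsmul_eq_mul, mul_one] at h2
    have h3 := hitProb_le_succ (T := T) t (T.parent v)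
    rw [one_sub_limitProb, one_div_mul_eq_div, le_div_iff₀ (by linarith)]
    linarith

/-- The reverse of `hitProb_le` in the limit. The limit F is harmonic off the root, and the same
computation runs by induction on the level, starting from the trivial bound 0 ≤ F. -/
lemma le_of_tendsto_hitProb {F : V → ℝ}
    (hF : ∀ v, Tendsto (fun t => T.hitProb t v) atTop (𝓝 (F v))) (h : ℕ) {v : V}
    (hv : v ≠ T.root) : (1 - T.levelProb h v) * F (T.parent v) ≤ F v := by
  induction h generalizing v with
  | zero =>
    rw [levelProb, sub_self, zero_mul]
    exact ge_of_tendsto' (hF v) fun t => hitProb_nonneg t v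
  | succ h ih =>
    have h1 : F v * (T.b v + 1) = F (T.parent v) + ∑ i, F (T.child v i) := by
      refine tendsto_nhds_unique
        (((tendsto_add_atTop_iff_nat 1).2 (hF v)).mul_const (T.b v + 1 : ℝ)) ?_
      simp only [hitProb_succ_mul _ hv]
      exact (hF _).add (tendsto_finsetSum _ fun i _ => hF _)
    have h2 : ∑ i, (1 - T.levelProb h (T.child v i)) * F v ≤ ∑ i, F (T.child v i) :=
      Finset.sum_le_sum fun i _ => by
        have := ih (T.child_ne_root (v := v) i)
        rwa [T.parent_child] at this
    rw [← Finset.sum_mul, Finset.sum_sub_distrib, Finset.sum_const, Finset.card_univ,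
      Fintype.card_fin, nsmul_eq_mul, mul_one] at h2
    have hS : 0 ≤ ∑ i, T.levelProb h (T.child v i) :=
      Finset.sum_nonneg fun i _ => levelProb_nonneg _ _
    have h3 : 1 - T.levelProb (h + 1) v = 1 / (1 + ∑ i, T.levelProb h (T.child v i)) := by
      rw [levelProb]
      field_simp
      ring
    rw [h3, one_div_mul_eq_div, div_le_iff₀ (by linarith)]
    linarith

lemma tendsto_hitProb_parent_root :
    Tendsto (fun t => T.hitProb t (T.parent T.root)) atTop
      (𝓝 (1 - T.limitProb (T.parent T.root))) := by
  have hF : ∀ v, Tendsto (fun t => T.hitProb t v) atTop (𝓝 (⨆ t, T.hitProb t v)) := fun v =>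
    tendsto_atTop_ciSup (monotone_nat_of_le_succ fun t => hitProb_le_succ t v)
      ⟨1, by rintro _ ⟨t, rfl⟩; exact hitProb_le_one t v⟩
  have hroot : ⨆ t, T.hitProb t T.root = 1 := by simp [hitProb_root]
  have hne := T.parent_root_ne_root
  have hle : ⨆ t, T.hitProb t (T.parent T.root) ≤ 1 - T.limitProb (T.parent T.root) :=
    ciSup_le fun t => by
      simpa [T.parent_parent_root, hitProb_root] using hitProb_le t hne
  have hge : 1 - T.limitProb (T.parent T.root) ≤ ⨆ t, T.hitProb t (T.parent T.root) :=
    le_of_tendsto' ((tendsto_levelProb (T.parent T.root)).const_sub 1) fun h => by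
      have := le_of_tendsto_hitProb hF h hne
      rwa [T.parent_parent_root, hroot, mul_one] at this
  rw [← hle.antisymm hge]
  exact hF _

end HitProb

/-! ### The trajectory measure and the escape probability. -/

section RandomWalk

variable [MeasurableSpace V] [DiscreteMeasurableSpace V]

variable {T}

open scoped ENNReal

lemma lintegral_srwKernel (v : V) (g : V → ℝ≥0∞) :
    ∫⁻ y, g y ∂(T.srwKernel v) = ∑ i, g (T.nbr v i) * ((T.b v : ℝ≥0∞) + 1)⁻¹ := by
  have : T.srwKernel v =
      ((PMF.uniformOfFintype (Fin (T.b v + 1))).map fun i => (T.nbr v i : V)).toMeasure := rfl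
  rw [this, ← PMF.toMeasure_map _ _ Measurable.of_discrete,
    lintegral_map Measurable.of_discrete Measurable.of_discrete, lintegral_fintype]
  refine Finset.sum_congr rfl fun i _ => ?_
  rw [PMF.toMeasure_apply_singleton _ _ (measurableSet_singleton _), PMF.uniformOfFintype_apply]
  simp

lemma lintegral_srwKernel_hitProb (t : ℕ) {v : V} (hv : v ≠ T.root) :
    ∫⁻ y, ENNReal.ofReal (1 - T.hitProb t y) ∂(T.srwKernel v) =
      ENNReal.ofReal (1 - T.hitProb (t + 1) v) := by
  rw [lintegral_srwKernel, ← Finset.sum_mul, ← ENNReal.ofReal_sum_of_nonneg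
    fun i _ => sub_nonneg.2 (hitProb_le_one t _)]
  have : ((T.b v : ℝ≥0∞) + 1)⁻¹ = ENNReal.ofReal ((T.b v : ℝ) + 1)⁻¹ := by
    rw [ENNReal.ofReal_inv_of_pos (by positivity), ENNReal.ofReal_add (by positivity) zero_le_one]
    simp
  rw [this, ← ENNReal.ofReal_mul (Finset.sum_nonneg fun i _ => sub_nonneg.2 (hitProb_le_one t _)),
    hitProb_succ_of_ne t hv, Finset.sum_sub_distrib]
  congr 1
  simp
  field_simp

lemma lintegral_srwKernel_root (g : V → ℝ≥0∞) :
    ∫⁻ y, g y ∂(T.srwKernel T.root) = g (T.parent T.root) := by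
  rw [lintegral_srwKernel, Fin.sum_univ_succ]
  have : IsEmpty (Fin (T.b T.root)) := by
    rw [T.b_root]
    infer_instance
  simp [T.b_root, parent]

/-- The one-step Markov property of simple random walk. -/
lemma lintegral_srwLaw_mul (v : V) (n : ℕ) {G : (Finset.Iic n → V) → ℝ≥0∞} (hG : Measurable G)
    (g : V → ℝ≥0∞) :
    ∫⁻ ω, G (Preorder.frestrictLe (π := fun _ => V) n ω) * g (ω (n + 1)) ∂(T.srwLaw v) =
      ∫⁻ ω, G (Preorder.frestrictLe (π := fun _ => V) n ω) *
        ∫⁻ y, g y ∂(T.srwKernel (ω n)) ∂(T.srwLaw v) := by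
  have hg : Measurable g := Measurable.of_discrete
  set κ : (n : ℕ) → Kernel (Finset.Iic n → V) V := fun n =>
    T.srwKernel.comap (fun x : (i : Finset.Iic n) → V => x ⟨n, by simp⟩)
      (measurable_pi_apply _) with hκ
  have hμ : T.srwLaw v = Kernel.traj (X := fun _ => V) κ 0 (fun _ => v) := rfl
  have h1 := Kernel.partialTraj_compProd_eq_map_traj (X := fun _ => V) (κ := κ) (Nat.zero_le n)
    (x₀ := fun _ => v)
  have hm : Measurable fun z : (Finset.Iic n → V) × V => G z.1 * g z.2 := by fun_prop
  have hk : Measurable fun y : V => ∫⁻ z, g z ∂(T.srwKernel y) := Measurable.of_discrete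
  have hm' : Measurable fun z : Finset.Iic n → V =>
      G z * ∫⁻ y, g y ∂(T.srwKernel (z ⟨n, by simp⟩)) :=
    hG.mul (hk.comp (measurable_pi_apply _))
  calc _ = ∫⁻ z, G z.1 * g z.2 ∂((T.srwLaw v).map fun ω =>
        (Preorder.frestrictLe (π := fun _ => V) n ω, ω (n + 1))) := by
        rw [lintegral_map hm (by fun_prop)]
    _ = ∫⁻ z, G z * ∫⁻ y, g y ∂(T.srwKernel (z ⟨n, by simp⟩))
        ∂(Kernel.partialTraj (X := fun _ => V) κ 0 n fun _ => v) := by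
        rw [hμ, ← h1, Measure.lintegral_compProd hm]
        refine lintegral_congr fun z => ?_
        exact lintegral_const_mul (μ := T.srwKernel (z ⟨n, by simp⟩)) (G z) hg
    _ = _ := by
        rw [← Kernel.traj_map_frestrictLe_apply, lintegral_map hm' (by fun_prop)]
        rfl

lemma srwLaw_zero (v : V) : ∀ᵐ ω ∂(T.srwLaw v), ω 0 = v := by
  have h := Kernel.traj_map_frestrictLe_apply (X := fun _ => V) (κ := fun n =>
    T.srwKernel.comap (fun x : (i : Finset.Iic n) → V => x ⟨n, by simp⟩)
      (measurable_pi_apply _)) 0 0 (fun _ => v)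
  rw [Kernel.partialTraj_self, Kernel.id_apply] at h
  have hs : MeasurableSet {z : Finset.Iic 0 → V | z ⟨0, by simp⟩ = v} :=
    measurable_pi_apply (X := fun _ : Finset.Iic 0 => V) ⟨0, by simp⟩
      (MeasurableSet.of_discrete (s := {v}))
  have h2 : ∀ᵐ z ∂((T.srwLaw v).map (Preorder.frestrictLe (π := fun _ => V) 0)),
      z ⟨0, by simp⟩ = v := by
    refine h ▸ ?_
    rw [ae_dirac_iff hs]
  exact ae_of_ae_map (Preorder.measurable_frestrictLe 0).aemeasurable h2

/-- Trajectories that avoid the root at the times `1, …, n`. -/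
def avoids (T : RotorTree V) (n : ℕ) : Set (ℕ → V) := {ω | ∀ t, 0 < t → t ≤ n → ω t ≠ T.root}

lemma measurableSet_avoids (n : ℕ) : MeasurableSet (T.avoids n) := by
  simp only [avoids, Set.ofPred_forall]
  refine MeasurableSet.iInter fun t => MeasurableSet.iInter fun _ => MeasurableSet.iInter fun _ => ?_
  exact measurable_pi_apply (X := fun _ : ℕ => V) t (MeasurableSet.of_discrete (s := {x | x ≠ T.root}))

lemma lintegral_avoids_succ (v : V) (n k : ℕ) :
    ∫⁻ ω, (T.avoids (n + 1)).indicator 1 ω * ENNReal.ofReal (1 - T.hitProb k (ω (n + 1)))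
        ∂(T.srwLaw v) =
      ∫⁻ ω, (T.avoids n).indicator 1 ω *
        ∫⁻ y, ENNReal.ofReal (1 - T.hitProb k y) ∂(T.srwKernel (ω n)) ∂(T.srwLaw v) := by
  classical
  let A : Set (Finset.Iic n → V) := {z | ∀ t : Finset.Iic n, 0 < (t : ℕ) → z t ≠ T.root}
  have hA : MeasurableSet A := by
    simp only [A, Set.ofPred_forall]
    refine MeasurableSet.iInter fun t => MeasurableSet.iInter fun _ => ?_
    exact measurable_pi_apply (X := fun _ : Finset.Iic n => V) t
      (MeasurableSet.of_discrete (s := {x | x ≠ T.root}))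
  have hmem : ∀ ω : ℕ → V, Preorder.frestrictLe (π := fun _ => V) n ω ∈ A ↔ ω ∈ T.avoids n :=
    fun ω => ⟨fun h t h0 ht => h ⟨t, by simpa using ht⟩ h0,
      fun h t h0 => h t h0 (Finset.mem_Iic.1 t.2)⟩
  have hind : ∀ ω : ℕ → V, A.indicator (1 : (Finset.Iic n → V) → ℝ≥0∞)
      (Preorder.frestrictLe (π := fun _ => V) n ω) = (T.avoids n).indicator 1 ω := fun ω => by
    simp only [Set.indicator_apply, hmem, Pi.one_apply]
  have h := lintegral_srwLaw_mul (T := T) v n (G := A.indicator 1) (measurable_one.indicator hA)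
    fun y => ENNReal.ofReal (1 - T.hitProb k y)
  simp only [hind] at h
  rw [← h]
  refine lintegral_congr fun ω => ?_
  -- The factor `1 - hitProb k` vanishes at the root, so avoiding the root at time n + 1 comes for
  -- free and only the past up to n remains in the indicator.
  by_cases hω : ω (n + 1) = T.root
  · simp [hω, hitProb_root]
  · have : ω ∈ T.avoids (n + 1) ↔ ω ∈ T.avoids n := by
      refine ⟨fun h t h0 ht => h t h0 (by omega), fun h t h0 ht => ?_⟩
      obtain rfl | ht := ht.eq_or_lt
      · exact hω
      · exact h t h0 (by omega)
    simp only [Set.indicator_apply, this]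

/-- By the Markov property, averaging `1 - hitProb k` over one step off the root gives `1 - hitProb
(k + 1)`. Each step back in n therefore raises k by one, until the forced first step from the root.
-/
lemma lintegral_avoids (n k : ℕ) :
    ∫⁻ ω, (T.avoids (n + 1)).indicator 1 ω * ENNReal.ofReal (1 - T.hitProb k (ω (n + 1)))
      ∂(T.srwLaw T.root) = ENNReal.ofReal (1 - T.hitProb (n + k) (T.parent T.root)) := by
  have : IsProbabilityMeasure (T.srwLaw T.root) := by
    unfold srwLaw
    infer_instance
  induction n generalizing k with
  | zero =>
    rw [lintegral_avoids_succ, zero_add]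
    have : ∀ᵐ ω ∂(T.srwLaw T.root), (T.avoids 0).indicator 1 ω *
        ∫⁻ y, ENNReal.ofReal (1 - T.hitProb k y) ∂(T.srwKernel (ω 0)) =
        ENNReal.ofReal (1 - T.hitProb k (T.parent T.root)) := by
      filter_upwards [srwLaw_zero T.root] with ω hω
      rw [hω, lintegral_srwKernel_root,
        Set.indicator_of_mem (fun t h0 ht => absurd h0 (by omega)), Pi.one_apply, one_mul]
    rw [lintegral_congr_ae this, lintegral_const, measure_univ, mul_one]
  | succ n ih =>
    rw [lintegral_avoids_succ, Nat.add_right_comm, Nat.add_assoc, ← ih (k + 1)]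
    refine lintegral_congr fun ω => ?_
    by_cases hω : ω ∈ T.avoids (n + 1)
    · rw [lintegral_srwKernel_hitProb k (hω (n + 1) (by omega) le_rfl)]
    · simp [hω]

/-- The case k = 0 of `lintegral_avoids`: `1 - hitProb 0` equals 1 off the root. The index shift is
the forced first step. -/
lemma srwLaw_avoids (n : ℕ) : T.srwLaw T.root (T.avoids (n + 1)) =
    ENNReal.ofReal (1 - T.hitProb n (T.parent T.root)) := by
  rw [← add_zero n, ← lintegral_avoids, add_zero, ← lintegral_indicator_one (measurableSet_avoids _)]
  refine lintegral_congr fun ω => ?_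
  by_cases hω : ω ∈ T.avoids (n + 1)
  · simp [hitProb_zero_of_ne (hω (n + 1) (by omega) le_rfl)]
  · simp [hω]

lemma escapeProb_eq : T.escapeProb = T.limitProb (T.parent T.root) := by
  have : IsProbabilityMeasure (T.srwLaw T.root) := by
    unfold srwLaw
    infer_instance
  have hset : {ω : ℕ → V | ∀ t, 0 < t → ω t ≠ T.root} = ⋂ n, T.avoids n := by
    ext ω
    simp only [avoids, Set.mem_iInter, Set.mem_ofPred_eq]
    exact ⟨fun h n t h0 _ => h t h0, fun h t h0 => h t t h0 le_rfl⟩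
  have hanti : Antitone T.avoids := fun a b hab ω h t h0 ht => h t h0 (ht.trans hab)
  have h1 : Tendsto (fun n => (T.srwLaw T.root) (T.avoids (n + 1))) atTop
      (𝓝 (T.srwLaw T.root {ω | ∀ t, 0 < t → ω t ≠ T.root})) := by
    rw [hset]
    exact (tendsto_add_atTop_iff_nat 1).2 (tendsto_measure_iInter_atTop
      (fun n => (measurableSet_avoids n).nullMeasurableSet) hanti ⟨0, measure_ne_top _ _⟩)
  have h2 := (ENNReal.tendsto_toReal (measure_ne_top _ _)).comp h1
  refine tendsto_nhds_unique h2 ?_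
  have h3 := (tendsto_hitProb_parent_root (T := T)).const_sub 1
  rw [sub_sub_cancel] at h3
  refine h3.congr fun n => ?_
  rw [Function.comp_apply, srwLaw_avoids,
    ENNReal.toReal_ofReal (sub_nonneg.2 (hitProb_le_one _ _))]

end RandomWalk

end RotorTree

theorem theorem3 {V : Type*} [Infinite V] [MeasurableSpace V] [DiscreteMeasurableSpace V]
    (T : RotorTree V) (r : T.RotorConfig)
    (hr : {v : V | v ≠ T.root ∧ (r v : ℕ) = T.b v}.Finite) :
    Tendsto (fun n : ℕ => (T.escapes r n : ℝ) / n) atTop (𝓝 T.escapeProb) := by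
  simp only [RotorTree.escapes_eq, RotorTree.escapeProb_eq]
  exact RotorTree.tendsto_excursionEscapes_div hr T.parent_root_ne_root
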